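/- A hemiring is an algebra $(R,+,\cdot,0)$ such that $(R,+,0)$ is a commutative monoid, $(R,\cdot)$ is a semigroup, multiplication distributes over addition on both sides, and $0r=0=r0$ for all $r\in R$ (an identity element is not required). Homomorphisms preserve $+,\cdot,0$. An ideal of $R$ is a nonempty subset closed under addition and under multiplication by elements of $R$ on either side; it is itself a hemiring. An ideal $I$ is subtractive if $x+a\in I$ and $a\in I$ imply $x\in I$. For an ideal $I$, $R/I$ is the factor hemiring of $R$ by the congruence $r\equiv_I r'$ iff $r+x=r'+x'$ for some $x,x'\in I$. A left $R$-semimodule is a commutative monoid $(M,+,0_M)$ with a scalar multiplication $R\times M\to M$ satisfying $(rr')m=r(r'm)$, $r(m+m')=rm+rm'$, $(r+r')m=rm+r'm$ and $r0_M=0_M=0m$ (it is not required to be unitary, even if $R$ happens to have an identity element). Its annihilator is the ideal $(0:M)_R=\{r\in R\mid rM=0\}$, and $RM\neq 0$ means that $rm\ne 0_M$ for some $r\in R$, $m\in M$. If $I$ is an ideal of $R$, then every $R/I$-semimodule is an $R$-semimodule by $rm=\overline{r}m$, and every $R$-semimodule $M$ with $I\subseteq(0:M)_R$ is an $R/I$-semimodule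 by $\overline{r}m=rm$. A nonempty class $\mathbb{R}$ of hemirings is a radical class (of the class $\mathbb{H}$ of all hemirings) if (a) every image of a member of $\mathbb{R}$ under a surjective hemiring homomorphism is in $\mathbb{R}$, and (b) every hemiring $R\notin\mathbb{R}$ has a subtractive ideal $I\neq R$ such that the only ideal of $R/I$ belonging to $\mathbb{R}$ is the zero ideal. Write $\varrho_{\mathbb{R}}(R)$ for the union of all ideals of $R$ that belong to $\mathbb{R}$. For a class $\Sigma$ consisting, for each hemiring $R$, of a class $\Sigma_R$ of left $R$-semimodules $M$ with $RM\ne0$, put $\ker(\Sigma_R)=\bigcap\{(0:M)_R\mid M\in\Sigma_R\}$ (equal to $R$ if $\Sigma_R=\emptyset$) and $\Re(\Sigma)=\{R\in\mathbb{H}\mid\Sigma_R=\emptyset\}$, and consider the following conditions, for all hemirings $R$: (SM1) if $I$ is an ideal of $R$ and $M\in\Sigma_{R/I}$, then $M\in\Sigma_R$; (SM2) if $M\in\Sigma_R$ and $I$ is an ideal of $R$ with $I\subseteq(0:M)_R$, then $M\in\Sigma_{R/I}$; (SM3) if $\ker(\Sigma_R)=0$, then $\Sigma_I\neq\emptyset$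 for all nonzero ideals $I$ of $R$; (SM4) if $\Sigma_I\neq\emptyset$ for each nonzero ideal $I$ of $R$, then $\ker(\Sigma_R)=0$. Theorem 3.4. Let $\mathbb{R}$ be a radical class of hemirings. For every hemiring $R$ let $\Sigma_R$ be the class of all left $R$-semimodules $M$ with $RM\neq0$ and $\varrho_{\mathbb{R}}(R/(0:M)_R)=0$, and let $\Sigma=\bigcup_R\Sigma_R$. Then: (i) $\Sigma$ satisfies (SM1)–(SM4); (ii) $\Re(\Sigma)=\mathbb{R}$. -/

import Mathlib

universe u

/-! A hemiring (associative, with an absorbing zero, no identity required) is Mathlib's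
`NonUnitalSemiring`; a hemiring homomorphism is a `NonUnitalRingHom`, written `R →ₙ+* S`. -/

namespace Hemiring

/-- A two-sided ideal of a hemiring: an additive submonoid that absorbs multiplication on either
side. (Mathlib's `TwoSidedIdeal` is a congruence, which is a different notion without
subtraction.) -/
structure HIdeal (R : Type u) [NonUnitalSemiring R] extends AddSubmonoid R where
  mul_mem_left' : ∀ (r : R) {x : R}, x ∈ carrier → r * x ∈ carrier
  mul_mem_right' : ∀ (r : R) {x : R}, x ∈ carrier → x * r ∈ carrier

namespace HIdeal

variable {R : Type u} [NonUnitalSemiring R]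

instance : SetLike (HIdeal R) R where
  coe I := I.carrier
  coe_injective := by
    rintro ⟨⟨⟨_, _⟩, _⟩, _, _⟩ ⟨⟨⟨_, _⟩, _⟩, _, _⟩ h
    congr

/-- Through this instance an ideal `I`, seen as the type `↥I`, is a hemiring under the restricted
operations. -/
instance : NonUnitalSubsemiringClass (HIdeal R) R where
  add_mem {I} _ _ hx hy := I.add_mem' hx hy
  zero_mem I := I.zero_mem'
  mul_mem {I} x _ _ hy := I.mul_mem_left' x hy

/-- The ideal is the zero ideal. -/
def IsZero (I : HIdeal R) : Prop := (I : Set R) = {0}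

/-- A subtractive ideal: `x + a ∈ I` and `a ∈ I` imply `x ∈ I`. -/
def IsSubtractive (I : HIdeal R) : Prop := ∀ x a : R, x + a ∈ I → a ∈ I → x ∈ I

/-- The Bourne congruence of an ideal `I`: `r ≡ r'` iff `r + x = r' + x'` for some
`x, x' ∈ I`. -/
def bourne (I : HIdeal R) : RingCon R where
  r a b := ∃ x ∈ I, ∃ y ∈ I, a + x = b + y
  iseqv :=
    { refl := fun _ => ⟨0, zero_mem I, 0, zero_mem I, rfl⟩
      symm := fun ⟨x, hx, y, hy, h⟩ => ⟨y, hy, x, hx, h.symm⟩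
      trans := by
        rintro a b c ⟨x, hx, y, hy, h⟩ ⟨z, hz, w, hw, k⟩
        refine ⟨x + z, add_mem hx hz, w + y, add_mem hw hy, ?_⟩
        rw [← add_assoc, h, add_right_comm, k, add_assoc] }
  add' := by
    rintro a b c d ⟨x, hx, y, hy, h⟩ ⟨z, hz, w, hw, k⟩
    refine ⟨x + z, add_mem hx hz, y + w, add_mem hy hw, ?_⟩
    rw [add_add_add_comm, h, k, add_add_add_comm]
  mul' := by
    rintro a b c d ⟨x, hx, y, hy, h⟩ ⟨z, hz, w, hw, k⟩
    refine ⟨a * z + x * c + x * z,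
      add_mem (add_mem (I.mul_mem_left' a hz) (I.mul_mem_right' c hx)) (I.mul_mem_right' z hx),
      b * w + y * d + y * w,
      add_mem (add_mem (I.mul_mem_left' b hw) (I.mul_mem_right' d hy)) (I.mul_mem_right' w hy), ?_⟩
    have e : (a + x) * (c + z) = (b + y) * (d + w) := by rw [h, k]
    simp only [add_mul, mul_add] at e
    calc a * c + (a * z + x * c + x * z) = a * c + a * z + (x * c + x * z) := by
          simp only [add_assoc]
      _ = b * d + b * w + (y * d + y * w) := by
          rw [add_add_add_comm, add_add_add_comm (b * d)]
          simpa only [add_assoc, add_left_comm] using e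
      _ = b * d + (b * w + y * d + y * w) := by simp only [add_assoc]

/-- The factor hemiring `R/I`, by the Bourne congruence of `I`. -/
abbrev Quot (I : HIdeal R) : Type u := I.bourne.Quotient

/-- The canonical surjection `R → R/I`. -/
abbrev proj (I : HIdeal R) (r : R) : I.Quot := (r : I.bourne.Quotient)

end HIdeal

/-- A left semimodule `M` over a hemiring `R`. -/
class Semimodule (R : Type u) (M : Type u) [NonUnitalSemiring R] [AddCommMonoid M]
    extends SMul R M where
  mul_smul' : ∀ (r s : R) (m : M), (r * s) • m = r • (s • m)
  smul_add' : ∀ (r : R) (m n : M), r • (m + n) = r • m + r • n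
  add_smul' : ∀ (r s : R) (m : M), (r + s) • m = r • m + s • m
  smul_zero' : ∀ r : R, r • (0 : M) = 0
  zero_smul' : ∀ m : M, (0 : R) • m = 0

namespace Semimodule

variable (R : Type u) (M : Type u) [NonUnitalSemiring R] [AddCommMonoid M]

/-- The annihilator `(0:M)_R = {r ∈ R | rM = 0}`. -/
def annihilator [Semimodule R M] : HIdeal R where
  carrier := {r | ∀ m : M, r • m = 0}
  add_mem' := by
    intro a b ha hb m
    rw [add_smul', ha m, hb m, add_zero]
  zero_mem' := zero_smul'
  mul_mem_left' := by
    intro r x hx m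
    rw [mul_smul', hx m, smul_zero']
  mul_mem_right' := by
    intro r x hx m
    rw [mul_smul', hx (r • m)]

/-- `RM ≠ 0`. -/
def ActsNontrivially [Semimodule R M] : Prop := ∃ (r : R) (m : M), r • m ≠ 0

variable {R} in
/-- An `R/I`-semimodule viewed as an `R`-semimodule: `r • m = (class of r) • m`. -/
abbrev ofQuot (I : HIdeal R) [Semimodule I.Quot M] : Semimodule R M where
  smul r m := I.proj r • m
  mul_smul' r s m := mul_smul' (I.proj r) (I.proj s) m
  smul_add' r m n := smul_add' (I.proj r) m n
  add_smul' r s m := add_smul' (I.proj r) (I.proj s) m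
  smul_zero' r := smul_zero' (I.proj r)
  zero_smul' m := zero_smul' (R := I.Quot) m

variable {R} in
/-- An `R`-semimodule with `I ⊆ (0:M)_R` viewed as an `R/I`-semimodule:
`(class of r) • m = r • m`. -/
abbrev toQuot (I : HIdeal R) [Semimodule R M] (h : (I : Set R) ⊆ annihilator R M) :
    Semimodule I.Quot M where
  smul q m := Quotient.liftOn q (fun r : R => r • m) (by
    rintro a b ⟨x, hx, y, hy, e⟩
    have hx' : x • m = 0 := h hx m
    have hy' : y • m = 0 := h hy m
    have e' := congrArg (fun r : R => r • m) e
    simpa only [add_smul', hx', hy', add_zero] using e')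
  mul_smul' := by
    rintro ⟨r⟩ ⟨s⟩ m
    exact mul_smul' r s m
  smul_add' := by
    rintro ⟨r⟩ m n
    exact smul_add' r m n
  add_smul' := by
    rintro ⟨r⟩ ⟨s⟩ m
    exact add_smul' r s m
  smul_zero' := by
    rintro ⟨r⟩
    exact smul_zero' r
  zero_smul' m := zero_smul' (R := R) m

end Semimodule

/-- A class of hemirings, as a predicate on hemirings. -/
abbrev HemiringClass : Type (u + 1) := ∀ (R : Type u) [NonUnitalSemiring R], Prop

/-- A radical class of hemirings (the universal class being that of all hemirings): it is nonempty,
closed under surjective homomorphic images, and every hemiring `R` outside it has a subtractive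
ideal `I ≠ R` such that the zero ideal is the one and only ideal of `R/I` that belongs to the
class. -/
structure IsRadicalClass (P : HemiringClass.{u}) : Prop where
  nonempty : ∃ (R : Type u) (_ : NonUnitalSemiring R), P R
  hom_closed : ∀ (R S : Type u) [NonUnitalSemiring R] [NonUnitalSemiring S] (f : R →ₙ+* S),
    Function.Surjective f → P R → P S
  exists_ideal : ∀ (R : Type u) [NonUnitalSemiring R], ¬ P R →
    ∃ I : HIdeal R, I.IsSubtractive ∧ (I : Set R) ≠ Set.univ ∧
      ∀ J : HIdeal I.Quot, P J ↔ J.IsZero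

/-- The `P`-radical of `R`: the union of all ideals of `R` that belong to `P`. -/
def radical (P : HemiringClass.{u}) (R : Type u) [NonUnitalSemiring R] : Set R :=
  ⋃ I ∈ {I : HIdeal R | P I}, (I : Set R)

/-- `R` is `P`-semisimple: its `P`-radical is zero. -/
def IsSemisimple (P : HemiringClass.{u}) (R : Type u) [NonUnitalSemiring R] : Prop :=
  radical P R = {0}

/-- A class `Σ` of semimodules over hemirings: for each hemiring `R` a class `Σ_R` of left
`R`-semimodules `M`, all with `RM ≠ 0`. Here `S.Mem R M` says `M ∈ Σ_R`. -/
structure SemimoduleClass where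
  Mem : ∀ (R : Type u) [NonUnitalSemiring R] (M : Type u) [AddCommMonoid M] [Semimodule R M], Prop
  acts : ∀ (R : Type u) [NonUnitalSemiring R] (M : Type u) [AddCommMonoid M] [Semimodule R M],
    Mem R M → Semimodule.ActsNontrivially R M

namespace SemimoduleClass

/-- `Σ_R ≠ ∅`. -/
def Inhabits (S : SemimoduleClass.{u}) (R : Type u) [NonUnitalSemiring R] : Prop :=
  ∃ (M : Type u) (_ : AddCommMonoid M) (_ : Semimodule R M), S.Mem R M

/-- `ker(Σ_R)`, the intersection of the annihilators `(0:M)_R` for `M ∈ Σ_R`; it is all of `R` if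
`Σ_R` is empty. -/
def ker (S : SemimoduleClass.{u}) (R : Type u) [NonUnitalSemiring R] : Set R :=
  {r | ∀ (M : Type u) [AddCommMonoid M] [Semimodule R M],
    S.Mem R M → r ∈ Semimodule.annihilator R M}

/-- If `M ∈ Σ_{R/I}`, then `M ∈ Σ_R`. -/
def SM1 (S : SemimoduleClass.{u}) : Prop :=
  ∀ (R : Type u) [NonUnitalSemiring R] (I : HIdeal R) (M : Type u) [AddCommMonoid M]
    [Semimodule I.Quot M], S.Mem I.Quot M → @Mem S R _ M _ (Semimodule.ofQuot M I)

/-- If `M ∈ Σ_R` and `I` is an ideal of `R` with `I ⊆ (0:M)_R`, then `M ∈ Σ_{R/I}`. -/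
def SM2 (S : SemimoduleClass.{u}) : Prop :=
  ∀ (R : Type u) [NonUnitalSemiring R] (I : HIdeal R) (M : Type u) [AddCommMonoid M]
    [Semimodule R M] (h : (I : Set R) ⊆ Semimodule.annihilator R M),
    S.Mem R M → @Mem S I.Quot _ M _ (Semimodule.toQuot M I h)

/-- If `ker(Σ_R) = 0`, then `Σ_I ≠ ∅` for all nonzero ideals `I` of `R`. -/
def SM3 (S : SemimoduleClass.{u}) : Prop :=
  ∀ (R : Type u) [NonUnitalSemiring R], S.ker R = {0} →
    ∀ I : HIdeal R, ¬ I.IsZero → S.Inhabits I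

/-- If `Σ_I ≠ ∅` for each nonzero ideal `I` of `R`, then `ker(Σ_R) = 0`. -/
def SM4 (S : SemimoduleClass.{u}) : Prop :=
  ∀ (R : Type u) [NonUnitalSemiring R],
    (∀ I : HIdeal R, ¬ I.IsZero → S.Inhabits I) → S.ker R = {0}

/-- `ℜ(Σ)`, the class of the hemirings `R` with `Σ_R = ∅`. -/
def radicalClass (S : SemimoduleClass.{u}) : HemiringClass.{u} := fun R _ => ¬ S.Inhabits R

/-- The class `Σ` given by a class `P` of hemirings: `Σ_R` consists of the left `R`-semimodules `M`
with `RM ≠ 0` and `R/(0:M)` a `P`-semisimple hemiring. -/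
def ofHemiringClass (P : HemiringClass.{u}) : SemimoduleClass.{u} where
  Mem R _ M _ _ :=
    Semimodule.ActsNontrivially R M ∧ IsSemisimple P (Semimodule.annihilator R M).Quot
  acts _ _ _ _ _ h := h.1

end SemimoduleClass

end Hemiring

/-! Everything rests on the equivalence `inhabits_iff`: a hemiring lies outside `P` exactly when it
has a semimodule in the class. A member of `P` has only trivial semisimple images, so it cannot act
nontrivially on a semimodule of the class. Conversely, a hemiring outside `P` has a nonzero
semisimple factor, and every nonzero semisimple hemiring acts faithfully on its `Unitization`, which
therefore belongs to the class (`mem_unitization`). SM1 and SM2 say that passing between `R` and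
`R/I` does not change the factor by the annihilator up to isomorphism (`isSemisimple_of_ker_eq`).
SM3 and SM4 then compare the kernel with the ideals belonging to `P`. -/

namespace Hemiring

open Semimodule

/-! ### Factor hemirings and images of ideals. -/

namespace HIdeal

variable {R S : Type u} [NonUnitalSemiring R] [NonUnitalSemiring S]

/-- The canonical surjection `R → R/I` as a homomorphism. -/
def projHom (I : HIdeal R) : R →ₙ+* I.Quot where
  toFun := I.proj
  map_mul' _ _ := rfl
  map_zero' := rfl
  map_add' _ _ := rfl

theorem projHom_surjective (I : HIdeal R) : Function.Surjective I.projHom := by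
  rintro ⟨r⟩
  exact ⟨r, rfl⟩

theorem projHom_eq_iff (I : HIdeal R) {a b : R} :
    I.projHom a = I.projHom b ↔ ∃ x ∈ I, ∃ y ∈ I, a + x = b + y :=
  I.bourne.eq

theorem projHom_eq_zero_of_mem (I : HIdeal R) {a : R} (ha : a ∈ I) : I.projHom a = 0 := by
  rw [← map_zero I.projHom, projHom_eq_iff]
  exact ⟨0, zero_mem I, a, ha, by rw [add_zero, zero_add]⟩

/-- The zero class of `R/I` is the subtractive closure of `I`, which can exceed `I` in general. -/
theorem IsSubtractive.projHom_eq_zero_iff {I : HIdeal R} (hI : I.IsSubtractive) {a : R} :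
    I.projHom a = 0 ↔ a ∈ I := by
  refine ⟨fun h => ?_, I.projHom_eq_zero_of_mem⟩
  rw [← map_zero I.projHom, projHom_eq_iff] at h
  obtain ⟨x, hx, y, hy, e⟩ := h
  refine hI a x ?_ hx
  rw [e, zero_add]
  exact hy

theorem isZero_iff {I : HIdeal R} : I.IsZero ↔ ∀ x ∈ I, x = 0 := by
  refine ⟨fun h x hx => ?_, fun h => Set.eq_singleton_iff_unique_mem.2 ⟨zero_mem I, h⟩⟩
  have hx' : x ∈ (I : Set R) := hx
  rwa [show (I : Set R) = {0} from h] at hx'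

/-- The image of an ideal under a surjective homomorphism. -/
def map (f : R →ₙ+* S) (hf : Function.Surjective f) (I : HIdeal R) : HIdeal S where
  carrier := f '' I
  add_mem' := by
    rintro _ _ ⟨a, ha, rfl⟩ ⟨b, hb, rfl⟩
    exact ⟨a + b, add_mem ha hb, map_add f a b⟩
  zero_mem' := ⟨0, zero_mem I, map_zero f⟩
  mul_mem_left' := by
    rintro s _ ⟨a, ha, rfl⟩
    obtain ⟨r, rfl⟩ := hf s
    exact ⟨r * a, I.mul_mem_left' r ha, map_mul f r a⟩
  mul_mem_right' := by
    rintro s _ ⟨a, ha, rfl⟩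
    obtain ⟨r, rfl⟩ := hf s
    exact ⟨a * r, I.mul_mem_right' r ha, map_mul f a r⟩

/-- The restriction of a surjective homomorphism to an ideal and its image. -/
def mapHom (f : R →ₙ+* S) (hf : Function.Surjective f) (I : HIdeal R) : I →ₙ+* I.map f hf where
  toFun x := ⟨f x, x, x.2, rfl⟩
  map_mul' _ _ := Subtype.ext (map_mul f _ _)
  map_zero' := Subtype.ext (map_zero f)
  map_add' _ _ := Subtype.ext (map_add f _ _)

theorem mapHom_surjective (f : R →ₙ+* S) (hf : Function.Surjective f) (I : HIdeal R) :
    Function.Surjective (I.mapHom f hf) := by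
  rintro ⟨_, a, ha, rfl⟩
  exact ⟨⟨a, ha⟩, rfl⟩

variable (R) in
/-- The zero ideal. -/
def zero : HIdeal R where
  carrier := {0}
  add_mem' := by
    rintro _ _ rfl rfl
    exact add_zero 0
  zero_mem' := rfl
  mul_mem_left' := by
    rintro r _ rfl
    exact mul_zero r
  mul_mem_right' := by
    rintro r _ rfl
    exact zero_mul r

variable (R) in
/-- The ideal consisting of all elements. -/
def top : HIdeal R where
  carrier := Set.univ
  add_mem' _ _ := trivial
  zero_mem' := trivial
  mul_mem_left' _ _ _ := trivial
  mul_mem_right' _ _ _ := trivial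

end HIdeal

/-! ### Annihilators and a faithful semimodule. -/

theorem Semimodule.annihilator_isSubtractive (R M : Type u) [NonUnitalSemiring R]
    [AddCommMonoid M] [Semimodule R M] : (annihilator R M).IsSubtractive := by
  intro x a hxa ha m
  have h : (x + a) • m = 0 := hxa m
  rwa [add_smul', ha m, add_zero] at h

/-- The additive monoid `R × ℕ`, on which `R` acts faithfully from the left. -/
abbrev Unitization (R : Type u) : Type u := R × ℕ

/-- The pair `(x, n)` stands for `x + n·1` with an adjoined identity, and `r(x + n·1) = rx + nr`
falls back into `R`, hence the second coordinate `0`. -/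
instance Unitization.semimodule (R : Type u) [NonUnitalSemiring R] :
    Semimodule R (Unitization R) where
  smul r m := (r * m.1 + m.2 • r, 0)
  mul_smul' r s m := by
    refine Prod.ext ?_ rfl
    change r * s * m.1 + m.2 • (r * s) = r * (s * m.1 + m.2 • s) + 0 • r
    rw [zero_nsmul, add_zero, mul_add, mul_assoc, mul_smul_comm]
  smul_add' r m n := by
    refine Prod.ext ?_ rfl
    change r * (m.1 + n.1) + (m.2 + n.2) • r = r * m.1 + m.2 • r + (r * n.1 + n.2 • r)
    rw [mul_add, add_nsmul, add_add_add_comm]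
  add_smul' r s m := by
    refine Prod.ext ?_ rfl
    change (r + s) * m.1 + m.2 • (r + s) = r * m.1 + m.2 • r + (s * m.1 + m.2 • s)
    rw [add_mul, nsmul_add, add_add_add_comm]
  smul_zero' r := by
    refine Prod.ext ?_ rfl
    change r * 0 + 0 • r = 0
    rw [mul_zero, zero_nsmul, add_zero]
  zero_smul' m := by
    refine Prod.ext ?_ rfl
    change 0 * m.1 + m.2 • (0 : R) = 0
    rw [zero_mul, nsmul_zero, add_zero]

theorem Unitization.smul_zero_one {R : Type u} [NonUnitalSemiring R] (r : R) :
    r • ((0, 1) : Unitization R) = (r, 0) := by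
  refine Prod.ext ?_ rfl
  change r * 0 + 1 • r = r
  rw [mul_zero, one_nsmul, zero_add]

theorem Unitization.eq_zero_of_mem_annihilator {R : Type u} [NonUnitalSemiring R] {r : R}
    (hr : r ∈ annihilator R (Unitization R)) : r = 0 :=
  congrArg Prod.fst ((smul_zero_one r).symm.trans (hr (0, 1)))

/-! ### Semisimplicity under surjective homomorphisms. -/

namespace IsRadicalClass

variable {P : HemiringClass.{u}}
  {R S T : Type u} [NonUnitalSemiring R] [NonUnitalSemiring S] [NonUnitalSemiring T]

/-- A one-element hemiring is the image of any member of the class under the zero map. -/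
theorem of_isZero (hP : IsRadicalClass P) {I : HIdeal R} (hI : I.IsZero) : P I := by
  obtain ⟨A, _, hA⟩ := hP.nonempty
  refine hP.hom_closed A I 0 (fun x => ⟨0, ?_⟩) hA
  exact Subtype.ext (HIdeal.isZero_iff.1 hI x x.2).symm

theorem isSemisimple_iff (hP : IsRadicalClass P) :
    IsSemisimple P R ↔ ∀ I : HIdeal R, P I → I.IsZero := by
  constructor
  · intro h I hI
    refine HIdeal.isZero_iff.2 fun x hx => ?_
    have hx' : x ∈ radical P R := Set.mem_biUnion (show I ∈ {I : HIdeal R | P I} from hI) hx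
    rwa [show radical P R = {0} from h] at hx'
  · intro h
    refine Set.eq_singleton_iff_unique_mem.2 ⟨?_, fun x hx => ?_⟩
    · have h0 : P (HIdeal.zero R) := hP.of_isZero rfl
      exact Set.mem_biUnion (show HIdeal.zero R ∈ {I : HIdeal R | P I} from h0) rfl
    · obtain ⟨I, hI, hx⟩ := Set.mem_iUnion₂.1 hx
      exact HIdeal.isZero_iff.1 (h I hI) x hx

/-- An ideal in the class is sent to zero by every homomorphism onto a semisimple hemiring. -/
theorem map_eq_zero (hP : IsRadicalClass P) (hS : IsSemisimple P S) (f : R →ₙ+* S)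
    (hf : Function.Surjective f) {I : HIdeal R} (hI : P I) {x : R} (hx : x ∈ I) : f x = 0 := by
  have h : P (I.map f hf) := hP.hom_closed I _ (I.mapHom f hf) (I.mapHom_surjective f hf) hI
  exact HIdeal.isZero_iff.1 (hP.isSemisimple_iff.1 hS _ h) (f x) ⟨x, hx, rfl⟩

theorem eq_zero_of_isSemisimple (hP : IsRadicalClass P) (hR : P R) (hS : IsSemisimple P S)
    (f : R →ₙ+* S) (hf : Function.Surjective f) (x : R) : f x = 0 := by
  -- `map_eq_zero` speaks of ideals, so `R` is replaced by its isomorphic copy, the improper ideal.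
  let g : R →ₙ+* HIdeal.top R :=
    { toFun := fun r => ⟨r, trivial⟩
      map_mul' := fun _ _ => rfl
      map_zero' := rfl
      map_add' := fun _ _ => rfl }
  have hg : P (HIdeal.top R) := hP.hom_closed R _ g (fun y => ⟨y, rfl⟩) hR
  exact hP.map_eq_zero hS f hf hg (x := x) trivial

/-- Semisimplicity is transported between two images of a hemiring with equal kernels. -/
theorem isSemisimple_of_ker_eq (hP : IsRadicalClass P) (hS : IsSemisimple P S)
    (f : R →ₙ+* S) (g : R →ₙ+* T) (hf : Function.Surjective f) (hg : Function.Surjective g)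
    (h : ∀ a b, f a = f b ↔ g a = g b) : IsSemisimple P T := by
  -- The value of `f` does not depend on the chosen `g`-preimage, so `f` factors through `g` as a
  -- homomorphism `k`.
  have hs (r : R) : f (Function.surjInv hg (g r)) = f r := (h _ _).2 (Function.surjInv_eq hg _)
  let k : T →ₙ+* S :=
    { toFun := fun t => f (Function.surjInv hg t)
      map_mul' := by
        intro t t'
        obtain ⟨a, rfl⟩ := hg t
        obtain ⟨b, rfl⟩ := hg t'
        rw [← map_mul g, hs, hs, hs, map_mul]
      map_zero' := by
        change f (Function.surjInv hg 0) = 0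
        rw [← map_zero g, hs, map_zero]
      map_add' := by
        intro t t'
        obtain ⟨a, rfl⟩ := hg t
        obtain ⟨b, rfl⟩ := hg t'
        change f (Function.surjInv hg (g a + g b)) =
          f (Function.surjInv hg (g a)) + f (Function.surjInv hg (g b))
        rw [← map_add g, hs, hs, hs, map_add] }
  have hk : Function.Surjective k := by
    intro s
    obtain ⟨r, rfl⟩ := hf s
    exact ⟨g r, hs r⟩
  refine hP.isSemisimple_iff.2 fun I hI => HIdeal.isZero_iff.2 fun x hx => ?_
  have hx0 : k x = 0 := hP.map_eq_zero hS k hk hI hx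
  obtain ⟨r, rfl⟩ := hg x
  have hr : f r = f 0 := by rw [map_zero, ← hs r]; exact hx0
  rw [(h r 0).1 hr, map_zero]

end IsRadicalClass

namespace HIdeal

variable {R : Type u} [NonUnitalSemiring R]

/-- The two factor hemirings `(R/I)/J` and `R/K` are images of `R` with equal kernels if `K` is the
preimage of `J`. -/
theorem projHom_projHom_eq_iff (I : HIdeal R) (J : HIdeal I.Quot) (K : HIdeal R)
    (hK : ∀ r, r ∈ K ↔ I.projHom r ∈ J) (a b : R) :
    (J.projHom.comp I.projHom) a = (J.projHom.comp I.projHom) b ↔ K.projHom a = K.projHom b := by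
  change J.projHom (I.projHom a) = J.projHom (I.projHom b) ↔ _
  rw [projHom_eq_iff, projHom_eq_iff]
  -- This lets `K` absorb the correction terms from `I` that arise when an equality in `R/I` is
  -- lifted to `R`.
  have hIK {i : R} (hi : i ∈ I) : i ∈ K := by
    rw [hK, I.projHom_eq_zero_of_mem hi]
    exact zero_mem J
  constructor
  · rintro ⟨x, hx, y, hy, e⟩
    obtain ⟨x, rfl⟩ := I.projHom_surjective x
    obtain ⟨y, rfl⟩ := I.projHom_surjective y
    rw [← map_add, ← map_add, projHom_eq_iff] at e
    obtain ⟨i, hi, j, hj, e⟩ := e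
    refine ⟨x + i, add_mem ((hK x).2 hx) (hIK hi), y + j, add_mem ((hK y).2 hy) (hIK hj), ?_⟩
    rw [← add_assoc, e, add_assoc]
  · rintro ⟨x, hx, y, hy, e⟩
    refine ⟨I.projHom x, (hK x).1 hx, I.projHom y, (hK y).1 hy, ?_⟩
    rw [← map_add, ← map_add, e]

end HIdeal

/-! ### The four conditions and the radical class. -/

namespace SemimoduleClass

variable {P : HemiringClass.{u}}

/-- Since `R` acts through `R/I`, its annihilator is by definition the preimage of the annihilator
in `R/I`. -/
theorem ofHemiringClass_sm1 (hP : IsRadicalClass P) : (ofHemiringClass P).SM1 := by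
  rintro R _ I M _ _ ⟨⟨q, m, hqm⟩, hss⟩
  let := ofQuot M I
  obtain ⟨r, rfl⟩ := I.projHom_surjective q
  exact ⟨⟨r, m, hqm⟩, hP.isSemisimple_of_ker_eq hss
    ((annihilator I.Quot M).projHom.comp I.projHom) (annihilator R M).projHom
    ((HIdeal.projHom_surjective _).comp I.projHom_surjective) (HIdeal.projHom_surjective _)
    (I.projHom_projHom_eq_iff _ _ fun _ => Iff.rfl)⟩

theorem ofHemiringClass_sm2 (hP : IsRadicalClass P) : (ofHemiringClass P).SM2 := by
  rintro R _ I M _ _ h ⟨⟨r, m, hrm⟩, hss⟩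
  let := toQuot M I h
  exact ⟨⟨I.projHom r, m, hrm⟩, hP.isSemisimple_of_ker_eq hss
    (annihilator R M).projHom ((annihilator I.Quot M).projHom.comp I.projHom)
    (HIdeal.projHom_surjective _) ((HIdeal.projHom_surjective _).comp I.projHom_surjective)
    fun a b => (I.projHom_projHom_eq_iff (annihilator I.Quot M) (annihilator R M)
      (fun _ => Iff.rfl) a b).symm⟩

/-- By faithfulness the Bourne congruence of the annihilator is equality, so the factor is a copy of
`R`. -/
theorem mem_unitization (hP : IsRadicalClass P) {R : Type u} [NonUnitalSemiring R]
    (hR : IsSemisimple P R) {r : R} (hr : r ≠ 0) : (ofHemiringClass P).Mem R (Unitization R) := by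
  refine ⟨⟨r, (0, 1), fun h => hr ?_⟩, hP.isSemisimple_of_ker_eq hR (NonUnitalRingHom.id R)
    (annihilator R (Unitization R)).projHom Function.surjective_id
    (HIdeal.projHom_surjective _) fun a b => ?_⟩
  · exact congrArg Prod.fst ((Unitization.smul_zero_one r).symm.trans h)
  · rw [HIdeal.projHom_eq_iff]
    constructor
    · intro h
      exact ⟨0, zero_mem _, 0, zero_mem _, by rw [show a = b from h]⟩
    · rintro ⟨x, hx, y, hy, e⟩
      rw [Unitization.eq_zero_of_mem_annihilator hx, Unitization.eq_zero_of_mem_annihilator hy,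
        add_zero, add_zero] at e
      exact e

/-- The factor by the annihilator is semisimple and an image of a member of `P`, hence zero;
subtractivity then puts all of `R` into the annihilator. -/
theorem not_inhabits_of_mem (hP : IsRadicalClass P) {R : Type u} [NonUnitalSemiring R] (hR : P R) :
    ¬ (ofHemiringClass P).Inhabits R := by
  rintro ⟨M, _, _, ⟨r, m, hrm⟩, hss⟩
  have h := hP.eq_zero_of_isSemisimple hR hss _ (HIdeal.projHom_surjective _) r
  exact hrm ((annihilator_isSubtractive R M).projHom_eq_zero_iff.1 h m)

theorem inhabits_of_not_mem (hP : IsRadicalClass P) {R : Type u} [NonUnitalSemiring R]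
    (hR : ¬ P R) : (ofHemiringClass P).Inhabits R := by
  obtain ⟨I, hI, hne, h⟩ := hP.exists_ideal R hR
  obtain ⟨r, hr⟩ := (Set.ne_univ_iff_exists_notMem _).1 hne
  have hr0 : I.projHom r ≠ 0 := fun h0 => hr (hI.projHom_eq_zero_iff.1 h0)
  have hss : IsSemisimple P I.Quot := hP.isSemisimple_iff.2 fun J => (h J).1
  exact ⟨Unitization I.Quot, _, _,
    ofHemiringClass_sm1 hP R I (Unitization I.Quot) (mem_unitization hP hss hr0)⟩

theorem inhabits_iff (hP : IsRadicalClass P) {R : Type u} [NonUnitalSemiring R] :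
    (ofHemiringClass P).Inhabits R ↔ ¬ P R :=
  ⟨fun h hR => not_inhabits_of_mem hP hR h, inhabits_of_not_mem hP⟩

/-- An ideal in `P` dies in every semisimple factor, so it lies in each annihilator and thus in the
kernel. -/
theorem ofHemiringClass_sm3 (hP : IsRadicalClass P) : (ofHemiringClass P).SM3 := by
  intro R _ hker I hI
  rw [inhabits_iff hP]
  refine fun hPI => hI (HIdeal.isZero_iff.2 fun x hx => ?_)
  have hx' : x ∈ (ofHemiringClass P).ker R := by
    intro M _ _ hM
    exact (annihilator_isSubtractive R M).projHom_eq_zero_iff.1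
      (hP.map_eq_zero hM.2 _ (HIdeal.projHom_surjective _) hPI hx)
  rwa [hker] at hx'

/-- No nonzero ideal lies in `P`, so `R` is semisimple and its faithful `Unitization` alone forces
the kernel to vanish. -/
theorem ofHemiringClass_sm4 (hP : IsRadicalClass P) : (ofHemiringClass P).SM4 := by
  intro R _ h
  have hss : IsSemisimple P R := hP.isSemisimple_iff.2 fun I hPI => by
    by_contra hI
    exact (inhabits_iff hP).1 (h I hI) hPI
  refine Set.eq_singleton_iff_unique_mem.2 ⟨fun M _ _ _ => zero_mem (annihilator R M),
    fun x hx => ?_⟩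
  by_contra hx0
  exact hx0 (Unitization.eq_zero_of_mem_annihilator
    (hx (Unitization R) (mem_unitization hP hss hx0)))

end SemimoduleClass

end Hemiring

theorem theorem3p4 (P : Hemiring.HemiringClass.{u}) (hP : Hemiring.IsRadicalClass P) :
    ((Hemiring.SemimoduleClass.ofHemiringClass P).SM1 ∧
      (Hemiring.SemimoduleClass.ofHemiringClass P).SM2 ∧
      (Hemiring.SemimoduleClass.ofHemiringClass P).SM3 ∧
      (Hemiring.SemimoduleClass.ofHemiringClass P).SM4) ∧
    P = (Hemiring.SemimoduleClass.ofHemiringClass P).radicalClass := by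
  refine ⟨⟨Hemiring.SemimoduleClass.ofHemiringClass_sm1 hP,
    Hemiring.SemimoduleClass.ofHemiringClass_sm2 hP,
    Hemiring.SemimoduleClass.ofHemiringClass_sm3 hP,
    Hemiring.SemimoduleClass.ofHemiringClass_sm4 hP⟩, ?_⟩
  funext R _
  exact propext (not_iff_comm.1 (Hemiring.SemimoduleClass.inhabits_iff hP).symm).symm
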